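/- Let $p_j\in(0,1/2]$ for every $j\in\mathbb Z$. The anisotropic random walk on $\mathbb Z^2$ is the Markov chain $\mathbf C(N)=(C_1(N),C_2(N))$, $N=0,1,2,\ldots$, which from a site $(k,j)$ moves to each of the two vertical neighbours $(k,j+1)$, $(k,j-1)$ with probability $p_j$ and to each of the two horizontal neighbours $(k+1,j)$, $(k-1,j)$ with probability $\tfrac12-p_j$. **Theorem 1.2.** Assume that $$\sum_{j=-k}^{k}\frac1{p_j}=Ck^{1+A}+O(k^{1+A-\delta}),\qquad k\to\infty,$$ for some constants $C>0$, $A>0$ and $0<\delta\le 1$. Then the anisotropic random walk is transient: from any starting point $z\in\mathbb Z^2$ (in particular from $(0,0)$), the probability of ever returning to $z$ is less than $1$, and almost surely every site of $\mathbb Z^2$ is visited only finitely often. -/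

import Mathlib

open MeasureTheory Filter

/-- One-step transition probabilities of the anisotropic walk on `ℤ²` (first coordinate
horizontal, second coordinate vertical). From a site `u` on the line `y = j`, each of the two
vertical neighbours has probability `p j` and each of the two horizontal neighbours has
probability `1 / 2 - p j`; all other sites have probability `0`. -/
noncomputable def anisotropicTransition (p : ℤ → ℝ) (u v : ℤ × ℤ) : ℝ :=
  if v = (u.1 + 1, u.2) ∨ v = (u.1 - 1, u.2) then 1 / 2 - p u.2
  else if v = (u.1, u.2 + 1) ∨ v = (u.1, u.2 - 1) then p u.2
  else 0

/-- `X 0, X 1, X 2, …` is a (time-homogeneous) Markov chain on `ℤ²` on the probability space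
`(Ω, μ)`, started at `z`, with the transition probabilities of the anisotropic walk. -/
structure IsAnisotropicWalk {Ω : Type*} [MeasurableSpace Ω] (p : ℤ → ℝ) (z : ℤ × ℤ)
    (μ : Measure Ω) (X : ℕ → Ω → ℤ × ℤ) : Prop where
  measurable : ∀ n, Measurable (X n)
  start : ∀ᵐ ω ∂μ, X 0 ω = z
  /-- `P(X₀ = x₀, …, X_{n+1} = x_{n+1}) = P(X₀ = x₀, …, X_n = x_n) p(x_n, x_{n+1})`. -/
  markov : ∀ (n : ℕ) (x : ℕ → ℤ × ℤ),
    μ.real {ω | ∀ i ≤ n + 1, X i ω = x i} =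
      μ.real {ω | ∀ i ≤ n, X i ω = x i} * anisotropicTransition p (x n) (x (n + 1))

/-- Transience of the anisotropic walk started at `z`: the probability of ever returning to the
starting point is less than `1`, and almost surely every site is visited only finitely often. -/
def IsTransientFrom {Ω : Type*} [MeasurableSpace Ω] (z : ℤ × ℤ) (μ : Measure Ω)
    (X : ℕ → Ω → ℤ × ℤ) : Prop :=
  μ {ω | ∃ n, 1 ≤ n ∧ X n ω = z} < 1 ∧
    ∀ᵐ ω ∂μ, ∀ v : ℤ × ℤ, {n : ℕ | X n ω = v}.Finite

/-! The walk is reversible for the weights `1 / p j`: it is the walk on the network with unit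
vertical conductances and horizontal conductances `c j = 1 / (2 p j) - 1`. Transience follows from a
bound of `f z ^ 2` by a constant times the energy of `f`, for all finitely supported `f`.

That bound (`exists_sq_le_mul_dirichletEnergy`) is a multiscale argument. Averages of `f` over
windows of the row through `z` run from `f z` (width 1) to 0 (width tending to infinity). By
`sq_rowAverage_window_sub_le`, replacing width `W` by `W'` through rows at distance at most `L`
costs order `L / W + W' / S` times the energy, where `S` is the total of `c` over those rows. With
`L` of order `2 ^ n`, `S` is at least of order `2 ^ ((1 + A) n)`; a width of order `2 ^ ((1 + A / 2)
n)` makes both terms of order `2 ^ (-A n / 2)`, and their square roots are summable.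

In `IsAnisotropicWalk.summable_real` the bound is applied to truncated Green functions, whose energy
is at most their value at `z`; hence they stay bounded. Borel–Cantelli gives finitely many visits,
and the Markov property then excludes certain return. -/

/-! ### Dirichlet energy. -/

/-- The Dirichlet energy on `ℤ²` with unit vertical conductances and conductance `c j` on the
horizontal edges of the line `y = j`. -/
noncomputable def dirichletEnergy (c : ℤ → ℝ) (f : ℤ × ℤ → ℝ) : ℝ :=
  ∑' v : ℤ × ℤ, (c v.2 * (f (v.1 + 1, v.2) - f v) ^ 2 + (f (v.1, v.2 + 1) - f v) ^ 2)

theorem finite_support_comp_add {f : ℤ × ℤ → ℝ} (hf : f.support.Finite) (d : ℤ × ℤ) :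
    (Function.support fun v => f (v + d)).Finite :=
  hf.preimage ((add_left_injective d).injOn)

theorem summable_dirichletEnergy (c : ℤ → ℝ) {f : ℤ × ℤ → ℝ} (hf : f.support.Finite) :
    Summable fun v : ℤ × ℤ =>
      c v.2 * (f (v.1 + 1, v.2) - f v) ^ 2 + (f (v.1, v.2 + 1) - f v) ^ 2 := by
  refine summable_of_hasFiniteSupport (((hf.union (finite_support_comp_add hf (1, 0))).union
    (finite_support_comp_add hf (0, 1))).subset fun v hv => ?_)
  by_contra h
  obtain ⟨a, b⟩ := v
  simp only [Set.mem_union, Function.mem_support, not_or, not_not, Prod.mk_add_mk, add_zero] at h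
  exact hv (by simp [h.1.1, h.1.2, h.2])

theorem sum_horizontal_le_dirichletEnergy {c : ℤ → ℝ} (hc : ∀ j, 0 ≤ c j) {f : ℤ × ℤ → ℝ}
    (hf : f.support.Finite) (s : Finset (ℤ × ℤ)) :
    ∑ v ∈ s, c v.2 * (f (v.1 + 1, v.2) - f v) ^ 2 ≤ dirichletEnergy c f := by
  refine (Finset.sum_le_sum fun v _ => ?_).trans
    ((summable_dirichletEnergy c hf).sum_le_tsum s fun v _ => ?_)
  · exact le_add_of_nonneg_right (sq_nonneg _)
  · exact add_nonneg (mul_nonneg (hc _) (sq_nonneg _)) (sq_nonneg _)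

theorem sum_vertical_le_dirichletEnergy {c : ℤ → ℝ} (hc : ∀ j, 0 ≤ c j) {f : ℤ × ℤ → ℝ}
    (hf : f.support.Finite) (s : Finset (ℤ × ℤ)) :
    ∑ v ∈ s, (f (v.1, v.2 + 1) - f v) ^ 2 ≤ dirichletEnergy c f := by
  refine (Finset.sum_le_sum fun v _ => ?_).trans
    ((summable_dirichletEnergy c hf).sum_le_tsum s fun v _ => ?_)
  · exact le_add_of_nonneg_left (mul_nonneg (hc _) (sq_nonneg _))
  · exact add_nonneg (mul_nonneg (hc _) (sq_nonneg _)) (sq_nonneg _)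

theorem dirichletEnergy_nonneg {c : ℤ → ℝ} (hc : ∀ j, 0 ≤ c j) (f : ℤ × ℤ → ℝ) :
    0 ≤ dirichletEnergy c f :=
  tsum_nonneg fun _ => add_nonneg (mul_nonneg (hc _) (sq_nonneg _)) (sq_nonneg _)

/-! ### Cauchy–Schwarz along lines, and row averages. -/

theorem Int.sum_Ico_sub (g : ℤ → ℝ) {a b : ℤ} (h : a ≤ b) :
    ∑ i ∈ Finset.Ico a b, (g (i + 1) - g i) = g b - g a := by
  induction b, h using Int.leInduction with
  | base => simp
  | succ b hb ih =>
    rw [← Finset.insert_Ico_right_eq_Ico_add_one hb, Finset.sum_insert (by simp), ih]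
    ring

theorem sq_sub_le_mul_sum_Ico (g : ℤ → ℝ) {a b : ℤ} (h : a ≤ b) :
    (g b - g a) ^ 2 ≤ ((b - a : ℤ) : ℝ) * ∑ i ∈ Finset.Ico a b, (g (i + 1) - g i) ^ 2 := by
  rw [← Int.sum_Ico_sub g h]
  refine sq_sum_le_card_mul_sum_sq.trans_eq ?_
  rw [Int.card_Ico]
  congr 1
  have : ((b - a).toNat : ℤ) = b - a := Int.toNat_of_nonneg (by omega)
  exact_mod_cast this

theorem sq_sub_le_mul_sum_Ico_of_abs_sub_le (g : ℤ → ℝ) {b j : ℤ} {L : ℕ} (h : |j - b| ≤ L) :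
    (g j - g b) ^ 2 ≤ L * ∑ i ∈ Finset.Ico (b - L) (b + L), (g (i + 1) - g i) ^ 2 := by
  obtain ⟨h1, h2⟩ := abs_le.1 h
  have key : ∀ x y : ℤ, x ≤ y → y - x ≤ L → b - L ≤ x → y ≤ b + L →
      (g y - g x) ^ 2 ≤ L * ∑ i ∈ Finset.Ico (b - L) (b + L), (g (i + 1) - g i) ^ 2 := by
    intro x y hxy hL hx hy
    refine (sq_sub_le_mul_sum_Ico g hxy).trans (mul_le_mul ?_ ?_ ?_ (Nat.cast_nonneg _))
    · exact_mod_cast hL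
    · exact Finset.sum_le_sum_of_subset_of_nonneg (Finset.Ico_subset_Ico hx hy)
        fun _ _ _ => sq_nonneg _
    · exact Finset.sum_nonneg fun _ _ => sq_nonneg _
  rcases le_total b j with hbj | hbj
  · exact key b j hbj (by omega) (by omega) (by omega)
  · rw [← neg_sub, neg_sq]
    exact key j b hbj (by omega) (by omega) (by omega)

/-- The average of `f` over the `W` sites to the right of `(a, j)`, this site included. -/
noncomputable def rowAverage (f : ℤ × ℤ → ℝ) (a : ℤ) (W : ℕ) (j : ℤ) : ℝ :=
  (∑ x ∈ Finset.Ico a (a + W), f (x, j)) / W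

theorem sq_sum_Ico_div_le (d : ℤ → ℝ) (a : ℤ) (W : ℕ) :
    ((∑ x ∈ Finset.Ico a (a + W), d x) / W) ^ 2 ≤
      (∑ x ∈ Finset.Ico a (a + W), d x ^ 2) / W := by
  have := sum_div_card_sq_le_sum_sq_div_card (s := Finset.Ico a (a + W)) (f := d)
  simpa using this

/-- The `W` columns of the window are disjoint vertical paths, so averaging over them gains the
factor `1 / W`. -/
theorem sq_rowAverage_sub_rowAverage_le {c : ℤ → ℝ} (hc : ∀ j, 0 ≤ c j) {f : ℤ × ℤ → ℝ}
    (hf : f.support.Finite) (a : ℤ) (W : ℕ) {b j : ℤ} {L : ℕ} (h : |j - b| ≤ L) :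
    (rowAverage f a W j - rowAverage f a W b) ^ 2 ≤ L / W * dirichletEnergy c f := by
  rw [rowAverage, rowAverage, ← sub_div, ← Finset.sum_sub_distrib]
  refine (sq_sum_Ico_div_le (fun x => f (x, j) - f (x, b)) a W).trans ?_
  rw [div_mul_eq_mul_div]
  gcongr
  refine (Finset.sum_le_sum fun x _ =>
    sq_sub_le_mul_sum_Ico_of_abs_sub_le (fun y => f (x, y)) h).trans ?_
  rw [← Finset.mul_sum]
  gcongr
  rw [← Finset.sum_product' (f := fun x y => (f (x, y + 1) - f (x, y)) ^ 2)]
  exact sum_vertical_le_dirichletEnergy hc hf _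

theorem sq_rowAverage_sub_le (f : ℤ × ℤ → ℝ) (a : ℤ) {W : ℕ} (hW : 0 < W) (j : ℤ) :
    (rowAverage f a W j - f (a, j)) ^ 2 ≤
      W * ∑ x ∈ Finset.Ico a (a + W), (f (x + 1, j) - f (x, j)) ^ 2 := by
  have hW' : (0 : ℝ) < W := Nat.cast_pos.2 hW
  have h1 : rowAverage f a W j - f (a, j) =
      (∑ x ∈ Finset.Ico a (a + W), (f (x, j) - f (a, j))) / W := by
    rw [rowAverage, Finset.sum_sub_distrib]
    simp
    field_simp
  rw [h1]
  refine (sq_sum_Ico_div_le (fun x => f (x, j) - f (a, j)) a W).trans ?_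
  rw [div_le_iff₀ hW']
  refine (Finset.sum_le_card_nsmul _ _
    (W * ∑ x ∈ Finset.Ico a (a + W), (f (x + 1, j) - f (x, j)) ^ 2) fun x hx => ?_).trans_eq ?_
  · obtain ⟨h2, h3⟩ := Finset.mem_Ico.1 hx
    refine (sq_sub_le_mul_sum_Ico (fun y => f (y, j)) h2).trans (mul_le_mul ?_ ?_ ?_ hW'.le)
    · have : x - a ≤ W := by omega
      exact_mod_cast this
    · exact Finset.sum_le_sum_of_subset_of_nonneg (Finset.Ico_subset_Ico le_rfl h3.le)
        fun _ _ _ => sq_nonneg _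
    · exact Finset.sum_nonneg fun _ _ => sq_nonneg _
  · simp [mul_comm]

/-- The point value `f (a, j)` does not depend on `W`, so it can serve as the intermediary between
two windows on row `j`. The weight `c j` turns the squared increments into horizontal energy. -/
theorem sum_mul_sq_rowAverage_sub_le {c : ℤ → ℝ} (hc : ∀ j, 0 ≤ c j) {f : ℤ × ℤ → ℝ}
    (hf : f.support.Finite) (a : ℤ) {W : ℕ} (hW : 0 < W) (J : Finset ℤ) :
    ∑ j ∈ J, c j * (rowAverage f a W j - f (a, j)) ^ 2 ≤ W * dirichletEnergy c f := by
  refine (Finset.sum_le_sum fun j _ =>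
    mul_le_mul_of_nonneg_left (sq_rowAverage_sub_le f a hW j) (hc j)).trans ?_
  simp_rw [mul_left_comm (c _) (W : ℝ), ← Finset.mul_sum]
  gcongr
  simp_rw [Finset.mul_sum]
  rw [Finset.sum_comm,
    ← Finset.sum_product' (f := fun x y => c y * (f (x + 1, y) - f (x, y)) ^ 2)]
  exact sum_horizontal_le_dirichletEnergy hc hf _

/-! ### Comparison of scales and the bound of point values. -/

/-- Two averages of `f` over windows of the line `y = b` are compared by going vertically to all
lines `y = j`, `j ∈ J`, weighted by their conductances, and changing the window there. -/
theorem sq_rowAverage_window_sub_le {c : ℤ → ℝ} (hc : ∀ j, 0 ≤ c j) {f : ℤ × ℤ → ℝ}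
    (hf : f.support.Finite) (a b : ℤ) {W W' L : ℕ} (hW : 0 < W) (hWW' : W ≤ W') {J : Finset ℤ}
    (hJ : ∀ j ∈ J, |j - b| ≤ L) (hS : 0 < ∑ j ∈ J, c j) :
    (rowAverage f a W b - rowAverage f a W' b) ^ 2 ≤
      8 * (L / W + W' / ∑ j ∈ J, c j) * dirichletEnergy c f := by
  set E := dirichletEnergy c f
  have hE : 0 ≤ E := dirichletEnergy_nonneg hc f
  set S := ∑ j ∈ J, c j with hSdef
  set D := (rowAverage f a W b - rowAverage f a W' b) ^ 2 with hD
  have hW' : 0 < W' := hW.trans_le hWW'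
  have h0 : (0 : ℝ) < W := Nat.cast_pos.2 hW
  have hle : (W : ℝ) ≤ W' := Nat.cast_le.2 hWW'
  have hLW : (L : ℝ) / W' * E ≤ L / W * E := by gcongr
  have h1 : ∀ j ∈ J, c j * D ≤ c j * (8 * (L / W * E)) +
      (4 * (c j * (rowAverage f a W j - f (a, j)) ^ 2) +
        4 * (c j * (rowAverage f a W' j - f (a, j)) ^ 2)) := by
    intro j hj
    have v1 := sq_rowAverage_sub_rowAverage_le hc hf a W (hJ j hj)
    have v2 := (sq_rowAverage_sub_rowAverage_le hc hf a W' (hJ j hj)).trans hLW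
    have : D ≤ 8 * (L / W * E) + (4 * (rowAverage f a W j - f (a, j)) ^ 2 +
        4 * (rowAverage f a W' j - f (a, j)) ^ 2) := by
      set p := rowAverage f a W j - rowAverage f a W b
      set q := rowAverage f a W' j - rowAverage f a W' b
      set r := rowAverage f a W j - f (a, j)
      set s := rowAverage f a W' j - f (a, j)
      have : D = (r - s - p + q) ^ 2 := by rw [hD]; congr 1; simp only [p, q, r, s]; ring
      rw [this]
      -- The square of a sum of four terms is at most four times the sum of squares; the hints are
      -- the squared pairwise differences of `r, -s, -p, q`.
      nlinarith [sq_nonneg (r + s), sq_nonneg (r + p), sq_nonneg (r - q), sq_nonneg (s - p),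
        sq_nonneg (s + q), sq_nonneg (p + q)]
    refine (mul_le_mul_of_nonneg_left this (hc j)).trans_eq (by ring)
  have h2 := Finset.sum_le_sum h1
  rw [← Finset.sum_mul, Finset.sum_add_distrib, ← Finset.sum_mul, Finset.sum_add_distrib,
    ← Finset.mul_sum, ← Finset.mul_sum, ← hSdef] at h2
  have h3 := sum_mul_sq_rowAverage_sub_le hc hf a hW J
  have h4 := sum_mul_sq_rowAverage_sub_le hc hf a hW' J
  have h5 : (W : ℝ) * E ≤ W' * E := by gcongr
  have h6 : S * D ≤ S * (8 * (L / W + W' / S) * E) := by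
    have : S * (8 * (L / W + W' / S) * E) = S * (8 * (L / W * E)) + 8 * (W' * E) := by
      field_simp
    rw [this]
    linarith
  exact le_of_mul_le_mul_left h6 hS

theorem tendsto_rowAverage_zero {f : ℤ × ℤ → ℝ} (hf : f.support.Finite) (a b : ℤ) {W : ℕ → ℕ}
    (hW : Tendsto W atTop atTop) : Tendsto (fun n => rowAverage f a (W n) b) atTop (nhds 0) := by
  have hs : Summable fun v => |f v| := summable_of_hasFiniteSupport (hf.subset fun v hv => by
    simpa using hv)
  have hlim : Tendsto (fun n => (∑' v, |f v|) / (W n : ℝ)) atTop (nhds 0) :=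
    (tendsto_natCast_atTop_atTop.comp hW).const_div_atTop _
  refine squeeze_zero_norm (fun n => ?_) hlim
  rw [Real.norm_eq_abs, rowAverage, abs_div, Nat.abs_cast]
  gcongr
  refine (Finset.abs_sum_le_sum_abs _ _).trans ?_
  refine le_trans (le_of_eq ?_) (hs.sum_le_tsum
    (Finset.map ⟨fun x => (x, b), fun x y h => by simpa using h⟩ (Finset.Ico a (a + W n)))
    fun _ _ => abs_nonneg _)
  simp only [Finset.sum_map]
  rfl

/-- Growth of the horizontal conductances faster than linear, on average, gives a bound of point
values by the energy. -/
theorem exists_sq_le_mul_dirichletEnergy {c : ℤ → ℝ} (hc : ∀ j, 0 ≤ c j) {A κ : ℝ} (hA : 0 < A)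
    (hκ : 0 < κ)
    (hgrow : ∀ᶠ k : ℕ in atTop, κ * (k : ℝ) ^ (1 + A) ≤ ∑ j ∈ Finset.Icc (-(k : ℤ)) k, c j)
    (z : ℤ × ℤ) :
    ∃ K, 0 ≤ K ∧ ∀ f : ℤ × ℤ → ℝ, f.support.Finite → f z ^ 2 ≤ K * dirichletEnergy c f := by
  obtain ⟨k₀, hk₀⟩ := eventually_atTop.1 hgrow
  obtain ⟨a, b⟩ := z
  -- The factor `m` makes every `m * 2 ^ n` at least `k₀`, and `+ 1` keeps it positive.
  set m := k₀ + 1 with hm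
  -- Widths `(2 * t) ^ n` are the geometric mean of the height `2 ^ n` and the conductance sum `(2 *
  -- t * t) ^ n`, so both costs decay like `t⁻¹ ^ n`.
  set t : ℝ := (2 : ℝ) ^ (A / 2) with ht
  have ht1 : 1 < t := Real.one_lt_rpow (by norm_num) (by positivity)
  have ht0 : 0 < t := one_pos.trans ht1
  have htt : (2 : ℝ) ^ (1 + A) = 2 * t * t := by
    rw [ht, Real.rpow_add (by norm_num), Real.rpow_one, mul_assoc,
      ← Real.rpow_add (by norm_num), add_halves]
  let W : ℕ → ℕ := fun n => ⌈(2 * t) ^ n⌉₊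
  have hWge : ∀ n, (2 * t) ^ n ≤ (W n : ℝ) := fun n => Nat.le_ceil _
  have hWle : ∀ n, (W n : ℝ) ≤ 2 * (2 * t) ^ n := fun n => by
    have h1 : (1 : ℝ) ≤ (2 * t) ^ n := one_le_pow₀ (by linarith)
    have h2 : (W n : ℝ) < (2 * t) ^ n + 1 := Nat.ceil_lt_add_one (by positivity)
    linarith
  have hWpos : ∀ n, 0 < W n := fun n => Nat.ceil_pos.2 (by positivity)
  have hWmono : ∀ n, W n ≤ W (n + 1) := fun n =>
    Nat.ceil_mono (pow_le_pow_right₀ (by linarith) n.le_succ)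
  have hWtop : Tendsto W atTop atTop :=
    tendsto_nat_ceil_atTop.comp (tendsto_pow_atTop_atTop_of_one_lt (by linarith))
  set M : ℝ := 8 * ((m + b.natAbs) + 4 * t / κ) with hMdef
  have hM : 0 ≤ M := by positivity
  set ρ : ℝ := √(1 / t) with hρ
  have hρ0 : 0 ≤ ρ := Real.sqrt_nonneg _
  have hρ1 : ρ < 1 := by
    rw [hρ, Real.sqrt_lt' one_pos, one_pow, div_lt_one ht0]
    exact ht1
  have hρsq : ρ ^ 2 = 1 / t := Real.sq_sqrt (by positivity)
  refine ⟨M * (1 / (1 - ρ)) ^ 2, by positivity, fun f hf => ?_⟩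
  set E := dirichletEnergy c f with hEdef
  have hE : 0 ≤ E := dirichletEnergy_nonneg hc f
  set T : ℕ → ℝ := fun n => rowAverage f a (W n) b with hT
  have step : ∀ n, |T (n + 1) - T n| ≤ √(M * E) * ρ ^ n := by
    intro n
    set R := m * 2 ^ n with hR
    -- The rows are centred at 0, not at `b`, hence the extra `|b|`.
    set L := R + b.natAbs with hL
    have hRk : k₀ ≤ R := by
      have : 1 ≤ 2 ^ n := Nat.one_le_two_pow
      nlinarith
    have hSge : κ * (2 * t * t) ^ n ≤ ∑ j ∈ Finset.Icc (-(R : ℤ)) R, c j := by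
      refine le_trans ?_ (hk₀ R hRk)
      gcongr
      rw [← htt, ← Real.rpow_natCast, ← Real.rpow_mul (by norm_num), mul_comm (1 + A),
        Real.rpow_mul (by norm_num), Real.rpow_natCast]
      refine Real.rpow_le_rpow (by positivity) ?_ (by linarith)
      have : 2 ^ n ≤ R := Nat.le_mul_of_pos_left _ (by omega)
      exact_mod_cast this
    have hSpos : 0 < ∑ j ∈ Finset.Icc (-(R : ℤ)) R, c j := lt_of_lt_of_le (by positivity) hSge
    have hJ : ∀ j ∈ Finset.Icc (-(R : ℤ)) R, |j - b| ≤ L := by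
      intro j hj
      rw [Finset.mem_Icc] at hj
      rw [abs_le]
      omega
    have main := sq_rowAverage_window_sub_le hc hf a b (hWpos n) (hWmono n) hJ hSpos
    have b1 : (L : ℝ) / W n ≤ (m + b.natAbs) * (1 / t) ^ n := by
      rw [div_le_iff₀ (Nat.cast_pos.2 (hWpos n))]
      have e1 : (1 / t) ^ n * (2 * t) ^ n = (2 : ℝ) ^ n := by
        rw [← mul_pow]; congr 1; field_simp
      have e2 : (2 : ℝ) ^ n ≤ (1 / t) ^ n * W n := by
        rw [← e1]; gcongr; exact hWge n
      have e3 : (1 : ℝ) ≤ 2 ^ n := one_le_pow₀ (by norm_num)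
      calc (L : ℝ) = m * 2 ^ n + b.natAbs * 1 := by rw [hL, hR]; push_cast; ring
        _ ≤ m * 2 ^ n + b.natAbs * 2 ^ n := by gcongr
        _ = (m + b.natAbs) * 2 ^ n := by ring
        _ ≤ (m + b.natAbs) * ((1 / t) ^ n * W n) := by gcongr
        _ = _ := by ring
    have b2 : (W (n + 1) : ℝ) / ∑ j ∈ Finset.Icc (-(R : ℤ)) R, c j ≤ 4 * t / κ * (1 / t) ^ n := by
      rw [div_le_iff₀ hSpos]
      calc (W (n + 1) : ℝ) ≤ 2 * (2 * t) ^ (n + 1) := hWle _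
        _ = 4 * t / κ * (1 / t) ^ n * (κ * (2 * t * t) ^ n) := by
          rw [mul_pow (2 * t) t n, pow_succ, one_div, inv_pow]; field_simp; ring
        _ ≤ _ := by gcongr
    have b3 : (T (n + 1) - T n) ^ 2 ≤ (M * E) * (ρ ^ n) ^ 2 := by
      rw [← pow_mul, mul_comm n 2, pow_mul, hρsq, ← neg_sub, neg_sq]
      refine main.trans ?_
      calc 8 * ((L : ℝ) / W n + W (n + 1) / ∑ j ∈ Finset.Icc (-(R : ℤ)) R, c j) * E
          ≤ 8 * ((m + b.natAbs) * (1 / t) ^ n + 4 * t / κ * (1 / t) ^ n) * E := by gcongr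
        _ = M * E * (1 / t) ^ n := by rw [hMdef]; ring
    rw [← Real.sqrt_sq_eq_abs]
    refine (Real.sqrt_le_sqrt b3).trans_eq ?_
    rw [Real.sqrt_mul (by positivity), Real.sqrt_sq (by positivity)]
  -- At scale 0 the window is a single site.
  have hT0 : T 0 = f (a, b) := by
    have : Finset.Ico a (a + 1) = {a} := by ext; simp; omega
    simp [hT, W, rowAverage, this]
  have hbound : ∀ n, |f (a, b)| ≤ √(M * E) * (1 / (1 - ρ)) + |T n| := by
    intro n
    have h1 : |T n - T 0| ≤ √(M * E) * (1 / (1 - ρ)) := by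
      rw [← Finset.sum_range_sub]
      refine (Finset.abs_sum_le_sum_abs _ _).trans
        ((Finset.sum_le_sum fun i _ => step i).trans ?_)
      rw [← Finset.mul_sum]
      gcongr
      rw [one_div, ← tsum_geometric_of_lt_one hρ0 hρ1]
      exact (summable_geometric_of_lt_one hρ0 hρ1).sum_le_tsum _ fun _ _ => by positivity
    rw [← hT0]
    have := abs_sub_abs_le_abs_sub (T 0) (T n)
    rw [abs_sub_comm] at this
    linarith
  have hlim : |f (a, b)| ≤ √(M * E) * (1 / (1 - ρ)) := by
    have h1 : Tendsto (fun n => √(M * E) * (1 / (1 - ρ)) + |T n|) atTop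
        (nhds (√(M * E) * (1 / (1 - ρ)) + |0|)) :=
      ((tendsto_rowAverage_zero hf a b hWtop).abs).const_add _
    simpa using ge_of_tendsto' h1 hbound
  calc f (a, b) ^ 2 = |f (a, b)| ^ 2 := (sq_abs _).symm
    _ ≤ (√(M * E) * (1 / (1 - ρ))) ^ 2 := by gcongr
    _ = M * (1 / (1 - ρ)) ^ 2 * E := by
      rw [mul_pow, Real.sq_sqrt (by positivity)]; ring

/-! ### Summation by parts. -/

/-- Expand the square and translate one half by `d`; the weight must be constant along `d`, as `c`
is along horizontal steps. -/
theorem tsum_mul_sq_shift_sub {f : ℤ × ℤ → ℝ} (hf : f.support.Finite) (d : ℤ × ℤ)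
    {w : ℤ × ℤ → ℝ} (hw : ∀ v, w (v + d) = w v) :
    (Summable fun v => f v * (w v * (2 * f v - f (v + d) - f (v - d)))) ∧
    (Summable fun v => w v * (f (v + d) - f v) ^ 2) ∧
    ∑' v, w v * (f (v + d) - f v) ^ 2 =
      ∑' v, f v * (w v * (2 * f v - f (v + d) - f (v - d))) := by
  have hs : ∀ g : ℤ × ℤ → ℝ, Summable fun v => f v * g v := fun g =>
    summable_of_hasFiniteSupport (hf.subset fun v hv => left_ne_zero_of_mul hv)
  have h1 := hs fun v => w v * (f v - f (v - d))
  have h2 := hs fun v => w v * (f v - f (v + d))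
  have h1' : Summable fun v => f (v + d) * (w (v + d) * (f (v + d) - f (v + d - d))) :=
    (Equiv.addRight d).summable_iff.2 h1
  have e1 : ∑' v, f (v + d) * (w (v + d) * (f (v + d) - f (v + d - d))) =
      ∑' v, f v * (w v * (f v - f (v - d))) :=
    (Equiv.addRight d).tsum_eq fun v => f v * (w v * (f v - f (v - d)))
  have e2 : (fun v => w v * (f (v + d) - f v) ^ 2) = fun v =>
      f (v + d) * (w (v + d) * (f (v + d) - f (v + d - d))) + f v * (w v * (f v - f (v + d))) := by
    ext v
    rw [add_sub_cancel_right, hw]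
    ring
  refine ⟨hs _, ?_, ?_⟩
  · rw [e2]
    exact h1'.add h2
  · rw [e2, h1'.tsum_add h2, e1, ← h1.tsum_add h2]
    refine tsum_congr fun v => ?_
    ring

/-- Summation by parts. -/
theorem dirichletEnergy_eq_tsum (c : ℤ → ℝ) {f : ℤ × ℤ → ℝ} (hf : f.support.Finite) :
    dirichletEnergy c f = ∑' v : ℤ × ℤ, f v *
      (c v.2 * (2 * f v - f (v.1 + 1, v.2) - f (v.1 - 1, v.2)) +
        (2 * f v - f (v.1, v.2 + 1) - f (v.1, v.2 - 1))) := by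
  obtain ⟨a1, a2, a3⟩ := tsum_mul_sq_shift_sub hf (1, 0) (w := fun v => c v.2) (by simp)
  obtain ⟨b1, b2, b3⟩ := tsum_mul_sq_shift_sub hf (0, 1) (w := fun _ => 1) (by simp)
  have e := a2.tsum_add b2
  rw [a3, b3, ← a1.tsum_add b1] at e
  convert e using 1
  · refine tsum_congr fun v => ?_
    obtain ⟨x, y⟩ := v
    simp
  · refine tsum_congr fun v => ?_
    obtain ⟨x, y⟩ := v
    simp
    ring

/-! ### The Markov property and the Green function. -/

section

variable {Ω : Type*} [MeasurableSpace Ω] {p : ℤ → ℝ} {z : ℤ × ℤ} {μ : Measure Ω}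
  {X : ℕ → Ω → ℤ × ℤ}

theorem anisotropicTransition_nonneg (hp_pos : ∀ j, 0 < p j) (hp_le : ∀ j, p j ≤ 1 / 2)
    (u v : ℤ × ℤ) : 0 ≤ anisotropicTransition p u v := by
  unfold anisotropicTransition
  have := hp_pos u.2
  have := hp_le u.2
  split_ifs <;> linarith

/-- The Markov property for events prescribing a set of values at each time. -/
theorem IsAnisotropicWalk.measure_cylinder_succ [IsFiniteMeasure μ]
    (hX : IsAnisotropicWalk p z μ X) (S : ℕ → Set (ℤ × ℤ)) (n : ℕ) (u v : ℤ × ℤ) :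
    μ {ω | (∀ i < n, X i ω ∈ S i) ∧ X n ω = u ∧ X (n + 1) ω = v} =
      μ {ω | (∀ i < n, X i ω ∈ S i) ∧ X n ω = u} *
        ENNReal.ofReal (anisotropicTransition p u v) := by
  -- The chain hypothesis concerns single trajectories, so the event is split over its countably
  -- many pasts.
  let Y : Ω → Fin n → ℤ × ℤ := fun ω i => X i ω
  have hY : Measurable Y := measurable_pi_lambda _ fun i => hX.measurable i
  let T : Set (Fin n → ℤ × ℤ) := {y | ∀ i : Fin n, y i ∈ S i}
  let B : Set Ω := {ω | X n ω = u}
  let B' : Set Ω := {ω | X n ω = u ∧ X (n + 1) ω = v}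
  have hB : MeasurableSet B := hX.measurable n (measurableSet_singleton u)
  have hB' : MeasurableSet B' := hB.inter (hX.measurable (n + 1) (measurableSet_singleton v))
  have e1 : {ω | (∀ i < n, X i ω ∈ S i) ∧ X n ω = u ∧ X (n + 1) ω = v} =
      ⋃ y : T, Y ⁻¹' {y.1} ∩ B' := by
    ext ω
    simp only [Set.mem_ofPred_eq, Set.mem_iUnion, Set.mem_inter_iff, Set.mem_preimage,
      Set.mem_singleton_iff, Subtype.exists, exists_and_right, B', T, Y]
    refine and_congr_left fun _ => ⟨fun h => ⟨fun i : Fin n => X i ω, fun i => h i i.2, rfl⟩, ?_⟩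
    rintro ⟨y, h, rfl⟩ i hi
    exact h ⟨i, hi⟩
  have e2 : {ω | (∀ i < n, X i ω ∈ S i) ∧ X n ω = u} = ⋃ y : T, Y ⁻¹' {y.1} ∩ B := by
    ext ω
    simp only [Set.mem_ofPred_eq, Set.mem_iUnion, Set.mem_inter_iff, Set.mem_preimage,
      Set.mem_singleton_iff, Subtype.exists, exists_and_right, B, T, Y]
    refine and_congr_left fun _ => ⟨fun h => ⟨fun i : Fin n => X i ω, fun i => h i i.2, rfl⟩, ?_⟩
    rintro ⟨y, h, rfl⟩ i hi
    exact h ⟨i, hi⟩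
  have hdisj : ∀ D : Set Ω, Pairwise (Function.onFun Disjoint fun y : T => Y ⁻¹' {y.1} ∩ D) := by
    intro D y y' hne
    refine Set.disjoint_left.2 fun ω h h' => hne (Subtype.ext ?_)
    exact h.1.symm.trans h'.1
  have hmeas : ∀ y : T, MeasurableSet (Y ⁻¹' {y.1}) := fun y => hY (measurableSet_singleton _)
  rw [e1, e2, measure_iUnion (hdisj B') fun y => (hmeas y).inter hB',
    measure_iUnion (hdisj B) fun y => (hmeas y).inter hB, ← ENNReal.tsum_mul_right]
  refine tsum_congr fun y => ?_
  let x : ℕ → ℤ × ℤ := fun i =>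
    if h : i < n then y.1 ⟨i, h⟩ else if i = n then u else v
  have hxlt : ∀ i (h : i < n), x i = y.1 ⟨i, h⟩ := fun i h => dif_pos h
  have hxn : x n = u := by simp [x]
  have hxn1 : x (n + 1) = v := by simp [x]
  have f1 : Y ⁻¹' {y.1} ∩ B = {ω | ∀ i ≤ n, X i ω = x i} := by
    ext ω
    simp only [Set.mem_inter_iff, Set.mem_preimage, Set.mem_singleton_iff, Set.mem_ofPred_eq, B]
    constructor
    · rintro ⟨h1, h2⟩ i hi
      rcases hi.lt_or_eq with h | rfl
      · rw [hxlt i h, ← h1]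
      · rw [hxn, h2]
    · intro h
      refine ⟨funext fun i => ?_, (h n le_rfl).trans hxn⟩
      exact (h i i.2.le).trans (hxlt i i.2)
  have f2 : Y ⁻¹' {y.1} ∩ B' = {ω | ∀ i ≤ n + 1, X i ω = x i} := by
    have : Y ⁻¹' {y.1} ∩ B' = (Y ⁻¹' {y.1} ∩ B) ∩ {ω | X (n + 1) ω = v} := by
      ext ω
      simp [B, B', and_assoc]
    rw [this, f1]
    ext ω
    simp only [Set.mem_inter_iff, Set.mem_ofPred_eq]
    constructor
    · rintro ⟨h1, h2⟩ i hi
      rcases hi.lt_or_eq with h | rfl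
      · exact h1 i (Nat.lt_succ_iff.1 h)
      · rw [hxn1, h2]
    · intro h
      exact ⟨fun i hi => h i (hi.trans n.le_succ), (h _ le_rfl).trans hxn1⟩
  have key := hX.markov n x
  rw [hxn, hxn1, ← f1, ← f2] at key
  rw [← ofReal_measureReal, ← ofReal_measureReal, key, ENNReal.ofReal_mul measureReal_nonneg]

theorem tsum_mul_anisotropicTransition (g : ℤ × ℤ → ℝ) (v : ℤ × ℤ) :
    ∑' u, g u * anisotropicTransition p u v =
      (1 / 2 - p v.2) * (g (v.1 - 1, v.2) + g (v.1 + 1, v.2)) +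
        p (v.2 - 1) * g (v.1, v.2 - 1) + p (v.2 + 1) * g (v.1, v.2 + 1) := by
  obtain ⟨a, b⟩ := v
  rw [tsum_eq_sum (s := {(a - 1, b), (a + 1, b), (a, b - 1), (a, b + 1)})]
  · rw [Finset.sum_insert, Finset.sum_insert, Finset.sum_insert, Finset.sum_singleton]
    · have : ¬ (a = a - 1 ∧ b = b - 1) := by omega
      simp [anisotropicTransition, this]
      ring
    all_goals simp
    all_goals omega
  · rintro ⟨c, d⟩ h
    simp only [Finset.mem_insert, Finset.mem_singleton, Prod.mk.injEq, not_or] at h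
    unfold anisotropicTransition
    rw [if_neg, if_neg, mul_zero]
    all_goals simp only [Prod.mk.injEq]
    all_goals omega

theorem IsAnisotropicWalk.real_succ_eq [IsFiniteMeasure μ]
    (hX : IsAnisotropicWalk p z μ X) (hp_pos : ∀ j, 0 < p j) (hp_le : ∀ j, p j ≤ 1 / 2)
    (n : ℕ) (v : ℤ × ℤ) :
    μ.real {ω | X (n + 1) ω = v} =
      (1 / 2 - p v.2) * (μ.real {ω | X n ω = (v.1 - 1, v.2)} +
        μ.real {ω | X n ω = (v.1 + 1, v.2)}) +
      p (v.2 - 1) * μ.real {ω | X n ω = (v.1, v.2 - 1)} +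
      p (v.2 + 1) * μ.real {ω | X n ω = (v.1, v.2 + 1)} := by
  rw [← tsum_mul_anisotropicTransition fun u => μ.real {ω | X n ω = u}]
  have e : {ω | X (n + 1) ω = v} = ⋃ u, {ω | X n ω = u ∧ X (n + 1) ω = v} := by
    ext ω; simp
  have hm : ∀ u, μ {ω | X n ω = u ∧ X (n + 1) ω = v} =
      μ {ω | X n ω = u} * ENNReal.ofReal (anisotropicTransition p u v) := fun u => by
    simpa using hX.measure_cylinder_succ (fun _ => Set.univ) n u v
  rw [measureReal_def, e, measure_iUnion, ENNReal.tsum_toReal_eq fun u => measure_ne_top _ _]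
  · refine tsum_congr fun u => ?_
    rw [hm, ENNReal.toReal_mul, 
      ENNReal.toReal_ofReal (anisotropicTransition_nonneg hp_pos hp_le _ _), measureReal_def]
  · intro u u' hne
    exact Set.disjoint_left.2 fun ω h h' => hne (h.1.symm.trans h'.1)
  · exact fun u => (hX.measurable n (measurableSet_singleton u)).inter
      (hX.measurable (n + 1) (measurableSet_singleton v))

theorem IsAnisotropicWalk.real_zero_eq [IsProbabilityMeasure μ] (hX : IsAnisotropicWalk p z μ X)
    (v : ℤ × ℤ) : μ.real {ω | X 0 ω = v} = if v = z then 1 else 0 := by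
  split_ifs with h
  · rw [measureReal_def, h,
      (mem_ae_iff_prob_eq_one (s := {ω | X 0 ω = z})
        (hX.measurable 0 (measurableSet_singleton z))).1 hX.start,
      ENNReal.toReal_one]
  · rw [measureReal_eq_zero_iff, measure_eq_zero_iff_ae_notMem]
    filter_upwards [hX.start] with ω hω h'
    exact h (h'.symm.trans hω)

theorem IsAnisotropicWalk.finite_support [IsProbabilityMeasure μ]
    (hX : IsAnisotropicWalk p z μ X) (hp_pos : ∀ j, 0 < p j) (hp_le : ∀ j, p j ≤ 1 / 2) (n : ℕ) :
    (Function.support fun v => μ.real {ω | X n ω = v}).Finite := by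
  refine (Set.finite_Icc (z.1 - n, z.2 - n) (z.1 + n, z.2 + (n : ℤ))).subset ?_
  obtain ⟨a, b⟩ := z
  induction n with
  | zero =>
    intro v hv
    rw [Function.mem_support, hX.real_zero_eq] at hv
    have : v = (a, b) := by by_contra h; exact hv (if_neg h)
    simp [this]
  | succ n ih =>
    rintro ⟨x, y⟩ hv
    by_contra hout
    refine hv ?_
    have h0 : ∀ x' y' : ℤ, |x' - x| ≤ 1 → |y' - y| ≤ 1 → μ.real {ω | X n ω = (x', y')} = 0 := by
      intro x' y' hx hy
      by_contra hne
      have := ih hne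
      simp only [Set.mem_Icc, Prod.mk_le_mk] at this hout
      rw [abs_le] at hx hy
      push_cast at hout
      omega
    simp only
    rw [hX.real_succ_eq hp_pos hp_le]
    simp [h0]

/-- The Green function is bounded by the geometric mean of the constants in the bounds of point
values by the energy. -/
theorem IsAnisotropicWalk.summable_real [IsProbabilityMeasure μ]
    (hX : IsAnisotropicWalk p z μ X) (hp_pos : ∀ j, 0 < p j) (hp_le : ∀ j, p j ≤ 1 / 2)
    (hE : ∀ v : ℤ × ℤ, ∃ K, 0 ≤ K ∧ ∀ f : ℤ × ℤ → ℝ, f.support.Finite →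
      f v ^ 2 ≤ K * dirichletEnergy (fun j => 1 / (2 * p j) - 1) f) (v : ℤ × ℤ) :
    Summable fun n => μ.real {ω | X n ω = v} := by
  obtain ⟨K, hK, hKE⟩ := hE z
  obtain ⟨K', hK', hKE'⟩ := hE v
  let w : ℕ → ℤ × ℤ → ℝ := fun n v => μ.real {ω | X n ω = v}
  have hw : ∀ n v, 0 ≤ w n v := fun _ _ => measureReal_nonneg
  -- Expected visits before time `N`, divided by the reversible weight `1 / p`.
  let f : ℕ → ℤ × ℤ → ℝ := fun N v => ∑ n ∈ Finset.range N, w n v * p v.2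
  have hf0 : ∀ N v, 0 ≤ f N v := fun N v =>
    Finset.sum_nonneg fun n _ => mul_nonneg (hw n v) (hp_pos _).le
  have hfin : ∀ N, (f N).support.Finite := fun N => by
    refine ((Finset.range N).finite_toSet.biUnion fun n _ =>
      hX.finite_support hp_pos hp_le n).subset fun u hu => ?_
    obtain ⟨n, hn, hne⟩ := Finset.exists_ne_zero_of_sum_ne_zero hu
    exact Set.mem_biUnion hn (left_ne_zero_of_mul hne)
  -- The network Laplacian of the truncated Green function telescopes by the one-step recursion.
  have hlap : ∀ N u, (1 / (2 * p u.2) - 1) * (2 * f N u - f N (u.1 + 1, u.2) - f N (u.1 - 1, u.2)) +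
      (2 * f N u - f N (u.1, u.2 + 1) - f N (u.1, u.2 - 1)) = w 0 u - w N u := by
    intro N u
    induction N with
    | zero => simp [f]
    | succ N ih =>
      have hrec : w (N + 1) u = _ := hX.real_succ_eq hp_pos hp_le N u
      have hs : ∀ u, f (N + 1) u = f N u + w N u * p u.2 := fun u => Finset.sum_range_succ _ _
      simp only [hs]
      have hpu := (hp_pos u.2).ne'
      rw [hrec]
      change _ = w 0 u - ((1 / 2 - p u.2) * (w N (u.1 - 1, u.2) + w N (u.1 + 1, u.2)) +
        p (u.2 - 1) * w N (u.1, u.2 - 1) + p (u.2 + 1) * w N (u.1, u.2 + 1))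
      have e : w 0 u = _ + w N u := sub_eq_iff_eq_add.1 ih.symm
      rw [e]
      field_simp
      ring
  -- Pair `f N` with its Laplacian `w 0 - w N`: `w 0` is the unit mass at `z`, and the `w N` part
  -- only lowers the sum.
  have henergy : ∀ N, dirichletEnergy (fun j => 1 / (2 * p j) - 1) (f N) ≤ f N z := by
    intro N
    rw [dirichletEnergy_eq_tsum _ (hfin N)]
    have hs : ∀ g : ℤ × ℤ → ℝ, Summable fun v => f N v * g v := fun g =>
      summable_of_hasFiniteSupport ((hfin N).subset fun v hv => left_ne_zero_of_mul hv)
    calc _ = ∑' u, f N u * (w 0 u - w N u) := tsum_congr fun u => by rw [hlap N u]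
      _ ≤ ∑' u, f N u * w 0 u := (hs _).tsum_le_tsum (fun u =>
          mul_le_mul_of_nonneg_left (sub_le_self _ (hw N u)) (hf0 N u)) (hs _)
      _ = f N z := by
        rw [tsum_eq_single z fun u hu => ?_]
        · simp [w, hX.real_zero_eq]
        · simp [w, hX.real_zero_eq, hu]
  -- Self-improvement: `f N z ^ 2 ≤ K * f N z`.
  have hz : ∀ N, f N z ≤ K := by
    intro N
    have h1 := (hKE _ (hfin N)).trans (mul_le_mul_of_nonneg_left (henergy N) hK)
    by_contra! h
    nlinarith
  have hv : ∀ N, f N v ≤ √(K' * K) := fun N =>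
    Real.le_sqrt_of_sq_le ((hKE' _ (hfin N)).trans
      (mul_le_mul_of_nonneg_left ((henergy N).trans (hz N)) hK'))
  refine summable_of_sum_range_le (c := √(K' * K) / p v.2) (hw · v) fun N => ?_
  rw [le_div_iff₀ (hp_pos _), Finset.sum_mul]
  exact hv N

theorem ae_finite_visits [IsProbabilityMeasure μ] {v : ℤ × ℤ}
    (hs : Summable fun n => μ.real {ω | X n ω = v}) :
    ∀ᵐ ω ∂μ, {n : ℕ | X n ω = v}.Finite := by
  refine ae_finite_setOfPred_mem (s := fun n => {ω | X n ω = v}) ?_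
  have h := hs.tsum_ofReal_ne_top
  rwa [tsum_congr fun n => ofReal_measureReal (measure_ne_top _ _)] at h

/-! ### From finitely many visits to uncertain return. -/

/-- The Markov property at time `n`, on the event of being back at the starting point. -/
theorem IsAnisotropicWalk.measure_avoid_eq [IsProbabilityMeasure μ]
    (hX : IsAnisotropicWalk p z μ X) (n m : ℕ) (v : ℤ × ℤ) :
    μ {ω | X n ω = z ∧ (∀ i < m, 1 ≤ i → X (n + i) ω ≠ z) ∧ X (n + m) ω = v} =
      μ {ω | X n ω = z} * μ {ω | (∀ i < m, 1 ≤ i → X i ω ≠ z) ∧ X m ω = v} := by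
  have hz : μ {ω | X 0 ω = z} = 1 :=
    (mem_ae_iff_prob_eq_one (hX.measurable 0 (measurableSet_singleton z))).1 hX.start
  induction m generalizing v with
  | zero =>
    have h0 : ∀ v, v ≠ z → μ {ω | X 0 ω = v} = 0 := fun v hv => by
      rw [measure_eq_zero_iff_ae_notMem]
      filter_upwards [hX.start] with ω hω h'
      exact hv (h'.symm.trans hω)
    by_cases hv : v = z
    · subst hv; simp [hz]
    · have : {ω | X n ω = z ∧ X n ω = v} = ∅ := by
        ext ω
        simp only [Set.mem_ofPred_eq, Set.mem_empty_iff_false, iff_false]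
        rintro ⟨h1, h2⟩
        exact hv (h2.symm.trans h1)
      simp [h0 v hv, this]
  | succ m ih =>
    have step : ∀ k : ℕ, μ {ω | X k ω = z ∧ (∀ i < m + 1, 1 ≤ i → X (k + i) ω ≠ z) ∧
        X (k + (m + 1)) ω = v} = ∑' u, (if 1 ≤ m ∧ u = z then 0 else
          μ {ω | X k ω = z ∧ (∀ i < m, 1 ≤ i → X (k + i) ω ≠ z) ∧ X (k + m) ω = u}) *
            ENNReal.ofReal (anisotropicTransition p u v) := by
      intro k
      -- Free before time `k`, at `z` at time `k`, off `z` afterwards. If `m = 0`, time `k` is the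
      -- present and not the past, so `u = z` has to be required separately.
      let S : ℕ → Set (ℤ × ℤ) := fun i => {x | (i = k → x = z) ∧ (k < i → x ≠ z)}
      have e : {ω | X k ω = z ∧ (∀ i < m + 1, 1 ≤ i → X (k + i) ω ≠ z) ∧
          X (k + (m + 1)) ω = v} = ⋃ u, {ω | X k ω = z ∧
            (∀ i < m + 1, 1 ≤ i → X (k + i) ω ≠ z) ∧ X (k + m) ω = u ∧
              X (k + m + 1) ω = v} := by
        ext ω; simp [add_assoc]
      have hcyl : ∀ u, ¬ (1 ≤ m ∧ u = z) → ∀ ω, X (k + m) ω = u →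
          ((X k ω = z ∧ ∀ i < m, 1 ≤ i → X (k + i) ω ≠ z) ↔
            ((∀ i < k + m, X i ω ∈ S i) ∧ (m = 0 → u = z))) := by
        intro u hu ω hω
        constructor
        · rintro ⟨h1, h2⟩
          refine ⟨fun i hi => ⟨fun h => h ▸ h1, fun h => ?_⟩, ?_⟩
          · have := h2 (i - k) (by omega) (by omega)
            rwa [Nat.add_sub_cancel' h.le] at this
          · rintro rfl
            exact hω.symm.trans h1
        · rintro ⟨h1, h2⟩
          refine ⟨?_, fun i hi hi1 => (h1 (k + i) (by omega)).2 (by omega)⟩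
          rcases Nat.eq_zero_or_pos m with rfl | hm
          · exact hω.trans (h2 rfl)
          · exact (h1 k (by omega)).1 rfl
      rw [e, measure_iUnion]
      · refine tsum_congr fun u => ?_
        split_ifs with hu
        · rw [zero_mul]
          convert measure_empty (μ := μ)
          ext ω
          simp only [Set.mem_ofPred_eq, Set.mem_empty_iff_false, iff_false]
          rintro ⟨-, h, h', -⟩
          exact h m (by omega) hu.1 (h'.trans hu.2)
        · by_cases hm : m = 0 → u = z
          · have := hX.measure_cylinder_succ S (k + m) u v
            convert this using 2
            · ext ω
              simp only [Set.mem_ofPred_eq]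
              constructor
              · rintro ⟨h1, h2, h3, h4⟩
                exact ⟨((hcyl u hu ω h3).1 ⟨h1, fun i hi => h2 i (by omega)⟩).1, h3, h4⟩
              · rintro ⟨h1, h3, h4⟩
                obtain ⟨h5, h6⟩ := (hcyl u hu ω h3).2 ⟨h1, hm⟩
                refine ⟨h5, fun i hi hi1 => ?_, h3, h4⟩
                rcases (Nat.lt_succ_iff.1 hi).lt_or_eq with h | rfl
                · exact h6 i h hi1
                · rw [h3]
                  exact fun h => hu ⟨hi1, h⟩
            · congr 1
              ext ω
              simp only [Set.mem_ofPred_eq]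
              constructor
              · rintro ⟨h1, h2, h3⟩
                exact ⟨((hcyl u hu ω h3).1 ⟨h1, h2⟩).1, h3⟩
              · rintro ⟨h1, h3⟩
                obtain ⟨h5, h6⟩ := (hcyl u hu ω h3).2 ⟨h1, hm⟩
                exact ⟨h5, h6, h3⟩
          · push Not at hm
            obtain ⟨rfl, hne⟩ := hm
            have h1 : {ω | X k ω = z ∧ (∀ i < 0 + 1, 1 ≤ i → X (k + i) ω ≠ z) ∧
                X (k + 0) ω = u ∧ X (k + 0 + 1) ω = v} = ∅ := by
              ext ω
              simp only [Set.mem_ofPred_eq, Set.mem_empty_iff_false, iff_false]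
              rintro ⟨h, -, h', -⟩
              exact hne (h'.symm.trans h)
            have h2 : {ω | X k ω = z ∧ (∀ i < 0, 1 ≤ i → X (k + i) ω ≠ z) ∧
                X (k + 0) ω = u} = ∅ := by
              ext ω
              simp only [Set.mem_ofPred_eq, Set.mem_empty_iff_false, iff_false]
              rintro ⟨h, -, h'⟩
              exact hne (h'.symm.trans h)
            rw [h1, h2, measure_empty, zero_mul]
      · intro u u' hne
        exact Set.disjoint_left.2 fun ω h h' => hne (h.2.2.1.symm.trans h'.2.2.1)
      · intro u
        have hms : ∀ i, ∀ s : Set (ℤ × ℤ), MeasurableSet {ω | X i ω ∈ s} := fun i s =>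
          hX.measurable i s.to_countable.measurableSet
        refine (hms k {z}).inter (MeasurableSet.inter ?_
          ((hms (k + m) {u}).inter (hms (k + m + 1) {v})))
        change MeasurableSet {ω | ∀ i < m + 1, 1 ≤ i → X (k + i) ω ≠ z}
        simp only [Set.ofPred_forall]
        exact .iInter fun i => .iInter fun _ => .iInter fun _ => hms (k + i) {z}ᶜ
    have hdrop : ∀ (m : ℕ) (v : ℤ × ℤ), μ {ω | (∀ i < m, 1 ≤ i → X i ω ≠ z) ∧ X m ω = v} =
        μ {ω | X 0 ω = z ∧ (∀ i < m, 1 ≤ i → X (0 + i) ω ≠ z) ∧ X (0 + m) ω = v} := by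
      intro m v
      refine measure_congr ?_
      filter_upwards [hX.start] with ω hω
      simp only [zero_add, eq_iff_iff]
      exact ⟨fun h => ⟨hω, h⟩, fun h => h.2⟩
    rw [hdrop, step n, step 0, ← ENNReal.tsum_mul_left]
    refine tsum_congr fun u => ?_
    rw [← mul_assoc]
    congr 1
    split_ifs
    · simp
    · rw [ih, hdrop]

/-- If return were certain, restarting at each time `n` would show that almost surely every visit to
`z` is followed by another, so there could be no last visit. -/
theorem IsAnisotropicWalk.measure_return_lt_one [IsProbabilityMeasure μ]
    (hX : IsAnisotropicWalk p z μ X)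
    (hfin : ∀ᵐ ω ∂μ, {n : ℕ | X n ω = z}.Finite) :
    μ {ω | ∃ n, 1 ≤ n ∧ X n ω = z} < 1 := by
  have hms : ∀ i, ∀ s : Set (ℤ × ℤ), MeasurableSet {ω | X i ω ∈ s} := fun i s =>
    hX.measurable i s.to_countable.measurableSet
  refine prob_le_one.lt_of_ne fun hone => ?_
  have hret : ∀ᵐ ω ∂μ, ∃ n, 1 ≤ n ∧ X n ω = z := by
    refine (mem_ae_iff_prob_eq_one ?_).2 hone
    simp only [Set.ofPred_exists, Set.ofPred_and]
    exact .iUnion fun n => (MeasurableSet.const _).inter (hms n {z})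
  have hlast : ∀ n, ∀ᵐ ω ∂μ, X n ω = z → ∃ i, 1 ≤ i ∧ X (n + i) ω = z := by
    intro n
    let G : ℕ → Set Ω := fun m => {ω | ∀ i < m, 1 ≤ i → X i ω ≠ z}
    have hG : ∀ m, MeasurableSet (G m) := fun m => by
      simp only [G, Set.ofPred_forall]
      exact .iInter fun i => .iInter fun _ => .iInter fun _ => hms i {z}ᶜ
    have hG0 : μ (⋂ m, G m) = 0 := by
      rw [measure_eq_zero_iff_ae_notMem]
      filter_upwards [hret] with ω hω hmem
      obtain ⟨i, hi, hz⟩ := hω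
      exact Set.mem_iInter.1 hmem (i + 1) i i.lt_succ_self hi hz
    have hlim : Tendsto (fun m => μ (G m)) atTop (nhds 0) := by
      rw [← hG0]
      exact tendsto_measure_iInter_atTop (fun m => (hG m).nullMeasurableSet)
        (fun m m' h ω hω i hi => hω i (hi.trans_le h)) ⟨0, measure_ne_top _ _⟩
    have hsum : ∀ (s : Set Ω), MeasurableSet s → ∀ k, μ s = ∑' v, μ (s ∩ {ω | X k ω = v}) := by
      intro s hs k
      rw [← measure_iUnion, ← Set.inter_iUnion]
      · congr 1
        ext ω
        simp
      · intro v v' hne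
        exact Set.disjoint_left.2 fun ω h h' => hne (h.2.symm.trans h'.2)
      · exact fun v => hs.inter (hms k {v})
    -- Sum `measure_avoid_eq` over the position at time `n + m` and bound the probability of being
    -- at `z` at time `n` by 1.
    have hle : ∀ m, μ {ω | X n ω = z ∧ ∀ i < m, 1 ≤ i → X (n + i) ω ≠ z} ≤ μ (G m) := by
      intro m
      have hmeas : MeasurableSet {ω | X n ω = z ∧ ∀ i < m, 1 ≤ i → X (n + i) ω ≠ z} := by
        refine (hms n {z}).inter ?_
        change MeasurableSet {ω | ∀ i < m, 1 ≤ i → X (n + i) ω ≠ z}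
        simp only [Set.ofPred_forall]
        exact .iInter fun i => .iInter fun _ => .iInter fun _ => hms (n + i) {z}ᶜ
      rw [hsum _ hmeas (n + m), hsum _ (hG m) m]
      refine ENNReal.tsum_le_tsum fun v => ?_
      have := hX.measure_avoid_eq n m v
      calc _ = μ {ω | X n ω = z ∧ (∀ i < m, 1 ≤ i → X (n + i) ω ≠ z) ∧ X (n + m) ω = v} := by
            congr 1
            ext ω
            simp [and_assoc]
        _ ≤ 1 * μ {ω | (∀ i < m, 1 ≤ i → X i ω ≠ z) ∧ X m ω = v} := by
            rw [this]
            gcongr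
            exact prob_le_one
        _ = _ := one_mul _
    have hsub : ∀ m, {ω | X n ω = z ∧ ∀ i, 1 ≤ i → X (n + i) ω ≠ z} ⊆
        {ω | X n ω = z ∧ ∀ i < m, 1 ≤ i → X (n + i) ω ≠ z} :=
      fun m ω h => ⟨h.1, fun i _ => h.2 i⟩
    have hzero : μ {ω | X n ω = z ∧ ∀ i, 1 ≤ i → X (n + i) ω ≠ z} = 0 :=
      le_antisymm (ge_of_tendsto' hlim fun m => (measure_mono (hsub m)).trans (hle m)) zero_le
    rw [measure_eq_zero_iff_ae_notMem] at hzero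
    filter_upwards [hzero] with ω hω hz
    by_contra! h
    exact hω ⟨hz, h⟩
  refine IsProbabilityMeasure.ne_zero μ (ae_eq_bot.1 (eventually_false_iff_eq_bot.1 ?_))
  filter_upwards [hX.start, hfin, ae_all_iff.2 hlast] with ω h0 hf hl
  obtain ⟨N, hN, hmax⟩ := hf.exists_maximalFor id _ ⟨0, h0⟩
  obtain ⟨i, hi, hz⟩ := hl N hN
  have := hmax (j := N + i) hz (by simp)
  simp at this
  omega

/-! ### Growth of the conductances and conclusion. -/

/-- The horizontal conductances `1 / (2 p j) - 1` grow as the sums of `1 / p j`. -/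
theorem eventually_le_sum_conductance {C A δ : ℝ} (hC : 0 < C) (hA : 0 < A) (hδ : 0 < δ)
    (hsum : (fun k : ℕ => (∑ j ∈ Finset.Icc (-(k : ℤ)) (k : ℤ), 1 / p j)
        - C * (k : ℝ) ^ (1 + A)) =O[atTop] fun k : ℕ => (k : ℝ) ^ (1 + A - δ)) :
    ∀ᶠ k : ℕ in atTop, C / 8 * (k : ℝ) ^ (1 + A) ≤
      ∑ j ∈ Finset.Icc (-(k : ℤ)) k, (1 / (2 * p j) - 1) := by
  have hlo : ∀ r : ℝ, r < 1 + A →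
      (fun k : ℕ => (k : ℝ) ^ r) =o[atTop] fun k : ℕ => (k : ℝ) ^ (1 + A) := fun r hr => by
    refine Asymptotics.IsLittleO.comp_tendsto (f := fun x : ℝ => x ^ r)
      (g := fun x : ℝ => x ^ (1 + A)) ?_ tendsto_natCast_atTop_atTop
    refine (Asymptotics.isLittleO_iff_tendsto' ?_).2 ?_
    · filter_upwards [eventually_gt_atTop 0] with x hx h
      exact absurd h (Real.rpow_pos_of_pos hx _).ne'
    · refine (tendsto_rpow_neg_atTop (sub_pos.2 hr)).congr' ?_
      filter_upwards [eventually_gt_atTop 0] with x hx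
      rw [neg_sub, Real.rpow_sub hx]
  have h1 := (hsum.trans_isLittleO (hlo (1 + A - δ) (by linarith))).def (half_pos hC)
  -- The error takes at most `C / 2`, leaving `C / 4` after halving; `2 * k + 1 ≤ 3 * k` takes at
  -- most `3 * C / 24 = C / 8` of that.
  have h2 := (hlo 1 (by linarith)).def (c := C / 24) (by positivity)
  filter_upwards [h1, h2, eventually_ge_atTop 1] with k h1 h2 hk
  have hk' : (1 : ℝ) ≤ k := Nat.one_le_cast.2 hk
  have hpos : (0 : ℝ) ≤ (k : ℝ) ^ (1 + A) := by positivity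
  rw [Real.norm_eq_abs, Real.norm_eq_abs, abs_of_nonneg hpos] at h1 h2
  rw [Real.rpow_one, abs_of_nonneg (by positivity)] at h2
  have h3 := (abs_le.1 h1).1
  have e : ∑ j ∈ Finset.Icc (-(k : ℤ)) k, (1 / (2 * p j) - 1) =
      (∑ j ∈ Finset.Icc (-(k : ℤ)) k, 1 / p j) / 2 - (2 * k + 1) := by
    rw [Finset.sum_sub_distrib, Finset.sum_div]
    congr 1
    · refine Finset.sum_congr rfl fun j _ => ?_
      rw [div_div, mul_comm]
    · have : ((k : ℤ) + 1 + k).toNat = 2 * k + 1 := by omega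
      simp [this]
  rw [e]
  linarith

end

theorem theorem1p2 (p : ℤ → ℝ) (hp_pos : ∀ j, 0 < p j) (hp_le : ∀ j, p j ≤ 1 / 2)
    (C A δ : ℝ) (hC : 0 < C) (hA : 0 < A) (hδ_pos : 0 < δ) (hδ_le : δ ≤ 1)
    (hsum : (fun k : ℕ => (∑ j ∈ Finset.Icc (-(k : ℤ)) (k : ℤ), 1 / p j)
        - C * (k : ℝ) ^ (1 + A)) =O[atTop] fun k : ℕ => (k : ℝ) ^ (1 + A - δ))
    {Ω : Type*} [MeasurableSpace Ω] (μ : Measure Ω) [IsProbabilityMeasure μ]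
    (z : ℤ × ℤ) (X : ℕ → Ω → ℤ × ℤ) (hX : IsAnisotropicWalk p z μ X) :
    IsTransientFrom z μ X := by
  have hc : ∀ j, 0 ≤ 1 / (2 * p j) - 1 := fun j => by
    have := hp_pos j
    rw [sub_nonneg, le_div_iff₀ (by positivity)]
    linarith [hp_le j]
  have hE := exists_sq_le_mul_dirichletEnergy hc hA (by positivity : 0 < C / 8)
    (eventually_le_sum_conductance hC hA hδ_pos hsum)
  have hfin : ∀ v, ∀ᵐ ω ∂μ, {n : ℕ | X n ω = v}.Finite := fun v =>
    ae_finite_visits (hX.summable_real hp_pos hp_le hE v)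
  exact ⟨hX.measure_return_lt_one (hfin z), ae_all_iff.2 hfin⟩
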